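/- Let $G=(V,E)$ be a finite or infinite, locally finite, simple, connected, unweighted graph which is regular (all vertices have the same finite degree) and non-bipartite. For $x\in V$ and an integer $t\ge 0$ let $p_t(x,x)$ be the probability that simple random walk on $G$ started at $x$ is at $x$ at time $t$, where at each step the walk moves to a uniformly chosen neighbour of its current position. Let $\pi(x)=\dfrac{d(x)}{\sum_{y\in V}d(y)}$, where $d(y)$ is the degree of $y$, so that $\pi(x)=1/|V|$ if $G$ is finite and $\pi(x)=0$ if $G$ is infinite. Then for each $x\in V$: $$0\le p_t(x,x)-\pi(x)\quad\text{for every even } t\ge 0,$$ $$p_t(x,x)-\pi(x)\le \frac{18}{\sqrt t}\quad\text{for every even } t\ge 2,$$ $$\bigl|p_t(x,x)-\pi(x)\bigr|\le \frac{9}{\sqrt t}\quad\text{for every odd } t\ge 1.$$ -/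

import Mathlib

open scoped ENNReal

namespace SimpleRandomWalk

/-- One step of simple random walk on a locally finite graph: from `x`, move to a uniformly chosen
neighbour of `x`. (At an isolated vertex, where there is no neighbour, the walk stays put.) -/
noncomputable def step {V : Type*} (G : SimpleGraph V) [G.LocallyFinite] (x : V) : PMF V :=
  if h : (G.neighborFinset x).Nonempty then PMF.uniformOfFinset (G.neighborFinset x) h
  else PMF.pure x

/-- The law of the position at time `t` of simple random walk on `G` started at `x`. -/
noncomputable def law {V : Type*} (G : SimpleGraph V) [G.LocallyFinite] (x : V) : ℕ → PMF V
  | 0 => PMF.pure x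
  | t + 1 => (law G x t).bind (step G)

/-- The `t`-step transition probability `p_t(x, y)` of simple random walk on `G`. -/
noncomputable def transProb {V : Type*} (G : SimpleGraph V) [G.LocallyFinite]
    (t : ℕ) (x y : V) : ℝ :=
  (law G x t y).toReal

/-- The volume `∑ x, d(x) ∈ [0, ∞]` of `G`; for a finite graph this is twice the number of edges. -/
noncomputable def vol {V : Type*} (G : SimpleGraph V) [G.LocallyFinite] : ℝ≥0∞ :=
  ∑' x : V, (G.degree x : ℝ≥0∞)

/-- The quotient `π(x) = d(x) / vol(V)`, which is `0` when the volume is infinite. -/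
noncomputable def statProb {V : Type*} (G : SimpleGraph V) [G.LocallyFinite] (x : V) : ℝ :=
  ((G.degree x : ℝ≥0∞) / vol G).toReal

end SimpleRandomWalk

/-!
The walk is reversible and its stationary measure is uniform, so `p_{m+n}(x, x) - π` is the inner
product of the deviations of `p_m(x, ·)` and `p_n(x, ·)` from `π`. Hence even deviations are
nonnegative, and Cauchy–Schwarz controls odd deviations by even ones.

For the rate, `p_{2m}(x, x) - p_{2m+2}(x, x)` is, up to the factor `1 / d`, the Dirichlet energy of
the function `(p_{m+1}(x, ·), p_m(x, ·))` on the bipartite double cover, which is connected because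
`G` is not bipartite. This function has total mass `2`. It is at least `p_{2m}(x, x)` at some
vertex and falls below any level above `π` elsewhere, hence at some least distance `r` from that
vertex. A drop by `δ` along a geodesic costs energy at least `δ² / r`, while the ball where the
function is still above the level `τ` contains about `d r / 3` vertices, so that `τ d r` is at most
a constant. Multiplying the two bounds eliminates `r` and gives, for `β_m = p_{2m}(x, x) - π`, the
Nash-type inequality `β_m³ ≤ 54 (β_m - β_{m+1})`, whence `β_m² ≤ 27 / m`.
-/

namespace SimpleRandomWalk

open SimpleGraph

section Energy

variable {V : Type*} {G : SimpleGraph V} {f : V → ℝ} {M E τ δ : ℝ}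

/-- The squared increment of `f` along an unordered pair. Its sum over the edges of a graph is the
Dirichlet energy of `f`, in which each edge is counted once. -/
def sqDiff (f : V → ℝ) : Sym2 V → ℝ :=
  Sym2.lift ⟨fun u v => (f u - f v) ^ 2, fun _ _ => sub_sq_comm _ _⟩

theorem sqDiff_mk (f : V → ℝ) (u v : V) : sqDiff f s(u, v) = (f u - f v) ^ 2 := rfl

theorem sqDiff_nonneg (f : V → ℝ) (e : Sym2 V) : 0 ≤ sqDiff f e :=
  e.ind fun _ _ => sq_nonneg _

theorem mul_card_le_of_hasSum (hf : ∀ v, 0 ≤ f v) (hM : HasSum f M) (s : Finset V)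
    (hs : ∀ v ∈ s, τ ≤ f v) : τ * s.card ≤ M := by
  rw [mul_comm, ← nsmul_eq_mul]
  exact (Finset.card_nsmul_le_sum s f τ hs).trans (sum_le_hasSum s (fun v _ => hf v) hM)

theorem sum_sqDiff_le (hE : HasSum (fun e : G.edgeSet => sqDiff f e) E) (s : Finset (Sym2 V))
    (hs : ↑s ⊆ G.edgeSet) : ∑ e ∈ s, sqDiff f e ≤ E := by
  rw [← Finset.sum_congr rfl fun e he => Set.indicator_of_mem (hs he) (sqDiff f)]
  exact sum_le_hasSum s (fun e _ => Set.indicator_nonneg (fun e _ => sqDiff_nonneg f e) e)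
    (hasSum_subtype_iff_indicator.mp hE)

theorem sq_sub_le_length_mul_sum_edges (f : V → ℝ) {u v : V} (p : G.Walk u v) :
    (f u - f v) ^ 2 ≤ p.length * (p.edges.map (sqDiff f)).sum := by
  induction p with
  | nil => simp
  | @cons u w v h p ih =>
    simp only [Walk.length_cons, Walk.edges_cons, List.map_cons, List.sum_cons, sqDiff_mk]
    push_cast
    have hS : 0 ≤ (p.edges.map (sqDiff f)).sum :=
      List.sum_nonneg (by simpa using fun e _ => sqDiff_nonneg f e)
    set S := (p.edges.map (sqDiff f)).sum
    have hcross : 2 * ((f u - f w) * (f w - f v)) ≤ p.length * (f u - f w) ^ 2 + S := by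
      rcases p.length.eq_zero_or_pos with h0 | hpos
      · rw [h0, Nat.cast_zero, zero_mul] at ih
        have hwv : f w - f v = 0 := pow_eq_zero_iff two_ne_zero |>.mp (ih.antisymm (sq_nonneg _))
        simp [hwv, h0, hS]
      · have hn : (0 : ℝ) < p.length := by exact_mod_cast hpos
        refine le_of_mul_le_mul_left ?_ hn
        nlinarith [sq_nonneg (p.length * (f u - f w) - (f w - f v))]
    linear_combination hcross + ih

theorem sq_sub_le_dist_mul_energy (hE : HasSum (fun e : G.edgeSet => sqDiff f e) E) {u v : V}
    (huv : G.Reachable u v) : (f u - f v) ^ 2 ≤ G.dist u v * E := by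
  classical
  obtain ⟨p, hpath, hlength⟩ := huv.exists_path_of_dist
  refine (sq_sub_le_length_mul_sum_edges f p).trans ?_
  rw [hlength, ← List.sum_toFinset _ hpath.isTrail.edges_nodup]
  gcongr
  exact sum_sqDiff_le hE _ fun e he => p.edges_subset_edgeSet (List.mem_toFinset.mp he)

theorem dist_getVert_of_length_eq_dist {u v : V} {p : G.Walk u v} (hp : p.length = G.dist u v)
    {i : ℕ} (hi : i ≤ p.length) : G.dist u (p.getVert i) = i := by
  rw [← length_eq_dist_of_subwalk hp (p.isSubwalk_take i), Walk.take_length, min_eq_left hi]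

/-- The neighbourhoods of every third vertex of a geodesic are disjoint. -/
theorem exists_finset_dist_lt_card_ge [G.LocallyFinite] {d : ℕ} (hd : ∀ v, d ≤ G.degree v)
    {u v : V} (huv : 2 ≤ G.dist u v) :
    ∃ s : Finset V, (∀ w ∈ s, G.dist u w < G.dist u v) ∧ d * G.dist u v ≤ 4 * s.card := by
  classical
  have hreach : G.Reachable u v := .of_dist_ne_zero (by omega)
  obtain ⟨p, hp⟩ := hreach.exists_walk_length_eq_dist
  set r := (G.dist u v + 1) / 3
  have hdist : ∀ k < r, ∀ w ∈ G.neighborFinset (p.getVert (3 * k)),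
      G.dist u w ≤ 3 * k + 1 ∧ 3 * k ≤ G.dist u w + 1 := fun k hk w hw => by
    have := ((G.mem_neighborFinset _ _).mp hw).diff_dist_adj (u := u)
    rw [dist_getVert_of_length_eq_dist hp (by omega)] at this
    omega
  refine ⟨(Finset.range r).biUnion fun k => G.neighborFinset (p.getVert (3 * k)), ?_, ?_⟩
  · intro w hw
    obtain ⟨k, hk, hw⟩ := Finset.mem_biUnion.mp hw
    have := hdist k (Finset.mem_range.mp hk) w hw
    have := Finset.mem_range.mp hk
    omega
  · rw [Finset.card_biUnion]
    · calc d * G.dist u v ≤ d * (4 * r) := by gcongr; omega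
        _ = 4 * ∑ _k ∈ Finset.range r, d := by rw [Finset.sum_const, Finset.card_range]; ring
        _ ≤ 4 * ∑ k ∈ Finset.range r, (G.neighborFinset (p.getVert (3 * k))).card := by
          gcongr
          exact hd _
    · intro i hi j hj hij
      refine Finset.disjoint_left.mpr fun w hwi hwj => hij ?_
      have := hdist i (Finset.mem_range.mp hi) w hwi
      have := hdist j (Finset.mem_range.mp hj) w hwj
      omega

theorem degree_mul_sq_mul_le_of_adj [G.LocallyFinite] (hf : ∀ v, 0 ≤ f v) (hM : HasSum f M)
    (hE : HasSum (fun e : G.edgeSet => sqDiff f e) E) (hδ : 0 ≤ δ) {u v : V} (hu : τ + δ ≤ f u)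
    (hv : f v < τ) (huv : G.Adj u v) : G.degree u * δ ^ 2 * τ ≤ 2 * M * E := by
  classical
  set low := {w ∈ G.neighborFinset u | f w < τ} with hlow
  set high := {w ∈ G.neighborFinset u | ¬ f w < τ}
  have hτ : 0 < τ := (hf v).trans_lt hv
  have hcard : (G.degree u : ℝ) = low.card + high.card := by
    exact_mod_cast (Finset.card_filter_add_card_filter_not _).symm
  have hlow_pos : (1 : ℝ) ≤ low.card := by
    exact_mod_cast Finset.card_pos.mpr ⟨v, by simp [hlow, huv, hv]⟩
  have hτM : τ ≤ M := by
    simpa using mul_card_le_of_hasSum hf hM {u} (by simpa using by linarith)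
  have hhighM : τ * high.card ≤ M :=
    mul_card_le_of_hasSum hf hM high fun w hw => not_lt.mp (Finset.mem_filter.mp hw).2
  have hlowE : low.card * δ ^ 2 ≤ E := by
    have hinj : Set.InjOn (fun w => s(u, w)) low := fun _ _ _ _ h => Sym2.congr_right.mp h
    refine le_trans ?_ (sum_sqDiff_le hE (low.image fun w => s(u, w)) ?_)
    · rw [Finset.sum_image hinj, ← nsmul_eq_mul]
      refine Finset.card_nsmul_le_sum _ _ _ fun w hw => ?_
      have := (Finset.mem_filter.mp hw).2
      exact pow_le_pow_left₀ hδ (by linarith) 2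
    · intro e he
      obtain ⟨w, hw, rfl⟩ := Finset.mem_image.mp (Finset.mem_coe.mp he)
      exact (G.mem_neighborFinset u w).mp (Finset.mem_filter.mp hw).1
  have hdegree : G.degree u * τ ≤ 2 * M * low.card := by
    rw [hcard]
    nlinarith
  have hM0 : 0 ≤ M := hM.nonneg hf
  calc G.degree u * δ ^ 2 * τ = (G.degree u * τ) * δ ^ 2 := by ring
    _ ≤ (2 * M * low.card) * δ ^ 2 := by gcongr
    _ = 2 * M * (low.card * δ ^ 2) := by ring
    _ ≤ 2 * M * E := by gcongr

theorem mul_sq_mul_le_of_two_le_dist [G.LocallyFinite] {d : ℕ} (hd : ∀ v, d ≤ G.degree v)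
    (hf : ∀ v, 0 ≤ f v) (hM : HasSum f M) (hE : HasSum (fun e : G.edgeSet => sqDiff f e) E)
    (hδ : 0 ≤ δ) {u v : V} (hu : τ + δ ≤ f u) (hv : f v < τ) (huv : 2 ≤ G.dist u v)
    (hball : ∀ w, G.dist u w < G.dist u v → τ ≤ f w) : d * δ ^ 2 * τ ≤ 4 * M * E := by
  obtain ⟨s, hs, hcard⟩ := exists_finset_dist_lt_card_ge hd huv
  have hτ : 0 < τ := (hf v).trans_lt hv
  have hsM : τ * s.card ≤ M := mul_card_le_of_hasSum hf hM s fun w hw => hball w (hs w hw)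
  have hcard' : (d * G.dist u v : ℝ) ≤ 4 * s.card := by exact_mod_cast hcard
  have hE0 : 0 ≤ E := hE.nonneg fun _ => sqDiff_nonneg f _
  have hδE : δ ^ 2 ≤ G.dist u v * E :=
    (pow_le_pow_left₀ hδ (by linarith) 2).trans
      (sq_sub_le_dist_mul_energy hE (Reachable.of_dist_ne_zero (by omega)))
  calc d * δ ^ 2 * τ ≤ d * (G.dist u v * E) * τ := by gcongr
    _ = d * G.dist u v * (τ * E) := by ring
    _ ≤ 4 * s.card * (τ * E) := by gcongr
    _ = 4 * (τ * s.card) * E := by ring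
    _ ≤ 4 * M * E := by gcongr

theorem mul_sq_mul_le_mass_mul_energy [G.LocallyFinite] {d : ℕ} (hG : G.Connected)
    (hd : ∀ v, d ≤ G.degree v) (hf : ∀ v, 0 ≤ f v) (hM : HasSum f M)
    (hE : HasSum (fun e : G.edgeSet => sqDiff f e) E) (hδ : 0 ≤ δ) {u : V} (hu : τ + δ ≤ f u)
    (hlow : ∃ v, f v < τ) : d * δ ^ 2 * τ ≤ 4 * M * E := by
  obtain ⟨v, hv, hmin⟩ := exists_minimalFor_of_wellFoundedLT (fun w => f w < τ) (G.dist u) hlow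
  have hτ : 0 < τ := (hf v).trans_lt hv
  have hball : ∀ w, G.dist u w < G.dist u v → τ ≤ f w := fun w hw =>
    not_lt.mp fun hwτ => hw.not_ge (hmin hwτ hw.le)
  have hpos : 0 < G.dist u v := hG.pos_dist_of_ne (by rintro rfl; linarith)
  rcases hpos.nat_succ_le.eq_or_lt' with hone | htwo
  · have hM0 : 0 ≤ M := hM.nonneg hf
    have hE0 : 0 ≤ E := hE.nonneg fun _ => sqDiff_nonneg f _
    calc d * δ ^ 2 * τ ≤ G.degree u * δ ^ 2 * τ := by gcongr; exact hd u
      _ ≤ 2 * M * E := degree_mul_sq_mul_le_of_adj hf hM hE hδ hu hv (dist_eq_one_iff_adj.mp hone)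
      _ ≤ 4 * M * E := by gcongr; norm_num
  · exact mul_sq_mul_le_of_two_le_dist hd hf hM hE hδ hu hv htwo hball

end Energy

section DoubleCover

variable {V : Type*} {G : SimpleGraph V}

/-- The covering projection identifies the neighbours of `inl v` and of `inr v` with those of
`v`. -/
def neighborSetDoubleCoverEquiv (G : SimpleGraph V) :
    (p : V ⊕ V) → G.bipartiteDoubleCover.neighborSet p ≃ G.neighborSet (p.elim id id)
  | .inl _ =>
    { toFun := fun | ⟨.inr w, hw⟩ => ⟨w, hw⟩
      invFun := fun w => ⟨.inr w, w.2⟩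
      left_inv := fun | ⟨.inr _, _⟩ => rfl
      right_inv := fun _ => rfl }
  | .inr _ =>
    { toFun := fun | ⟨.inl w, hw⟩ => ⟨w, hw⟩
      invFun := fun w => ⟨.inl w, w.2⟩
      left_inv := fun | ⟨.inl _, _⟩ => rfl
      right_inv := fun _ => rfl }

instance [G.LocallyFinite] : G.bipartiteDoubleCover.LocallyFinite := fun p =>
  .ofEquiv _ (neighborSetDoubleCoverEquiv G p).symm

theorem degree_bipartiteDoubleCover [G.LocallyFinite] (p : V ⊕ V) :
    G.bipartiteDoubleCover.degree p = G.degree (p.elim id id) := by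
  simp only [← card_neighborSet_eq_degree]
  exact Fintype.card_congr (neighborSetDoubleCoverEquiv G p)

theorem exists_closed_walk_odd_length (hbip : ¬ G.IsBipartite) :
    ∃ u, ∃ c : G.Walk u u, Odd c.length := by
  simpa [IsBipartite, two_colorable_iff_forall_loop_even] using hbip

theorem reachable_bipartiteDoubleCover {u v : V} (p : G.Walk u v) :
    (Even p.length → G.bipartiteDoubleCover.Reachable (.inl u) (.inl v)) ∧
      (Odd p.length → G.bipartiteDoubleCover.Reachable (.inr u) (.inl v)) := by
  induction p with
  | nil => simp
  | @cons u w v h p ih =>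
    rw [Walk.length_cons, Nat.even_add_one, Nat.odd_add_one, Nat.not_even_iff_odd,
      Nat.not_odd_iff_even]
    have hlr : G.bipartiteDoubleCover.Adj (.inl u) (.inr w) := h
    have hrl : G.bipartiteDoubleCover.Adj (.inr u) (.inl w) := h
    exact ⟨fun hp => hlr.reachable.trans (ih.2 hp), fun hp => hrl.reachable.trans (ih.1 hp)⟩

theorem connected_bipartiteDoubleCover (hG : G.Connected) (hbip : ¬ G.IsBipartite) :
    G.bipartiteDoubleCover.Connected := by
  obtain ⟨a, c, hodd⟩ := exists_closed_walk_odd_length hbip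
  have hreach : ∀ p, G.bipartiteDoubleCover.Reachable p (.inl a) := by
    rintro (v | v) <;> obtain ⟨p⟩ := hG.preconnected v a <;>
      rcases p.length.even_or_odd with hp | hp
    · exact (reachable_bipartiteDoubleCover p).1 hp
    · exact (reachable_bipartiteDoubleCover (p.append c)).1
        (by simpa only [Walk.length_append] using hp.add_odd hodd)
    · exact (reachable_bipartiteDoubleCover (p.append c)).2
        (by simpa only [Walk.length_append] using hp.add_odd hodd)
    · exact (reachable_bipartiteDoubleCover p).2 hp
  exact { preconnected := fun p q => (hreach p).trans (hreach q).symm, nonempty := ⟨.inl a⟩ }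

/-- Each dart `(u, v)` of a graph is one edge, `{inl u, inr v}`, of its bipartite double cover. -/
noncomputable def dartEquivEdgeSetDoubleCover : G.Dart ≃ G.bipartiteDoubleCover.edgeSet :=
  .ofBijective (fun e => ⟨s(.inl e.fst, .inr e.snd), e.adj⟩) <| by
    constructor
    · rintro ⟨⟨u, v⟩, h⟩ ⟨⟨u', v'⟩, h'⟩ heq
      simpa using congrArg Subtype.val heq
    · rintro ⟨e, he⟩
      induction e with | _ p q
      match p, q, he with
      | .inl u, .inr v, he => exact ⟨⟨(u, v), he⟩, rfl⟩
      | .inr v, .inl u, he => exact ⟨⟨(u, v), G.adj_symm he⟩, Subtype.ext Sym2.eq_swap⟩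

theorem hasSum_sqDiff_sumElim_iff {f g : V → ℝ} {E : ℝ} :
    HasSum (fun e : G.bipartiteDoubleCover.edgeSet => sqDiff (Sum.elim f g) e) E ↔
      HasSum (fun e : G.Dart => (f e.fst - g e.snd) ^ 2) E :=
  dartEquivEdgeSetDoubleCover.hasSum_iff.symm

end DoubleCover

section Darts

variable {V : Type*} {G : SimpleGraph V} [G.LocallyFinite] {a : ℝ}

/-- Darts, grouped by their first vertex. -/
def sigmaNeighborSetEquivDart (G : SimpleGraph V) : (Σ v, G.neighborSet v) ≃ G.Dart where
  toFun p := G.dartOfNeighborSet p.1 p.2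
  invFun e := ⟨e.fst, e.snd, e.adj⟩
  left_inv _ := rfl
  right_inv _ := rfl

theorem hasSum_dart_of_nonneg {F : V → V → ℝ} (hF : ∀ v w, 0 ≤ F v w)
    (h : HasSum (fun v => ∑ w ∈ G.neighborFinset v, F v w) a) :
    HasSum (fun e : G.Dart => F e.fst e.snd) a := by
  have hfiber : ∀ v, HasSum (fun w : G.neighborSet v => F v w) (∑ w ∈ G.neighborFinset v, F v w) :=
    fun v => by
      simpa only [neighborFinset, Finset.sum_set_coe] using
        hasSum_fintype fun w : G.neighborSet v => F v w
  rw [← (sigmaNeighborSetEquivDart G).hasSum_iff]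
  refine h.sigma_of_hasSum hfiber ((summable_sigma_of_nonneg fun _ => hF _ _).mpr
    ⟨fun v => (hfiber v).summable, ?_⟩)
  exact h.summable.congr fun v => (hfiber v).tsum_eq.symm

theorem hasSum_dart_fst {d : ℕ} (hreg : G.IsRegularOfDegree d) {f : V → ℝ} (hf : ∀ v, 0 ≤ f v)
    (h : HasSum f a) : HasSum (fun e : G.Dart => f e.fst) (d * a) := by
  refine hasSum_dart_of_nonneg (fun v _ => hf v) ?_
  simpa only [Finset.sum_const, card_neighborFinset_eq_degree, hreg.degree_eq, nsmul_eq_mul]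
    using h.mul_left (d : ℝ)

theorem hasSum_dart_snd {d : ℕ} (hreg : G.IsRegularOfDegree d) {f : V → ℝ} (hf : ∀ v, 0 ≤ f v)
    (h : HasSum f a) : HasSum (fun e : G.Dart => f e.snd) (d * a) :=
  Dart.symm_involutive.toPerm.hasSum_iff.mpr (hasSum_dart_fst hreg hf h)

end Darts

theorem hasSum_toReal_of_tsum_eq {ι : Type*} {f : ι → ℝ≥0∞} {a : ℝ≥0∞} (h : ∑' i, f i = a)
    (ha : a ≠ ∞) : HasSum (fun i => (f i).toReal) a.toReal := by
  subst h
  rw [ENNReal.tsum_toReal_eq (ENNReal.ne_top_of_tsum_ne_top ha)]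
  exact ENNReal.hasSum_toReal ha

section Walk

variable {V : Type*} {G : SimpleGraph V} [G.LocallyFinite] {d : ℕ}

theorem pos_of_not_isBipartite (hreg : G.IsRegularOfDegree d) (hbip : ¬ G.IsBipartite) :
    0 < d := by
  obtain ⟨u, c, hodd⟩ := exists_closed_walk_odd_length hbip
  rw [← hreg.degree_eq u, degree_pos_iff_exists_adj]
  exact ⟨_, c.adj_snd fun hnil => by simp [Walk.length_eq_zero_iff.mpr hnil] at hodd⟩

theorem step_apply (hreg : G.IsRegularOfDegree d) (hd : 0 < d) (v w : V) [Decidable (G.Adj v w)] :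
    step G v w = if G.Adj v w then (d : ℝ≥0∞)⁻¹ else 0 := by
  have hcard : (G.neighborFinset v).card = d := hreg v
  have hne : (G.neighborFinset v).Nonempty := Finset.card_pos.mp (hcard ▸ hd)
  rw [step, dif_pos hne, PMF.uniformOfFinset_apply, hcard]
  simp only [mem_neighborFinset]

theorem step_comm (hreg : G.IsRegularOfDegree d) (hd : 0 < d) (v w : V) :
    step G v w = step G w v := by
  classical
  simp only [step_apply hreg hd, G.adj_comm]

theorem tsum_law_succ_mul_law (hreg : G.IsRegularOfDegree d) (hd : 0 < d) (x y : V) (m n : ℕ) :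
    ∑' z, law G x (m + 1) z * law G y n z = ∑' z, law G x m z * law G y (n + 1) z := by
  simp only [law, PMF.bind_apply, ← ENNReal.tsum_mul_left, ← ENNReal.tsum_mul_right]
  rw [ENNReal.tsum_comm]
  refine tsum_congr fun v => tsum_congr fun w => ?_
  rw [step_comm hreg hd v w]
  ring

theorem tsum_law_mul_law (hreg : G.IsRegularOfDegree d) (hd : 0 < d) (x y : V) (m n : ℕ) :
    ∑' z, law G x m z * law G y n z = law G x (m + n) y := by
  classical
  induction n generalizing m with
  | zero =>
    rw [tsum_eq_single y fun z hz => by simp [law, hz]]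
    simp [law]
  | succ n ih =>
    rw [← tsum_law_succ_mul_law hreg hd, ih, Nat.add_right_comm, Nat.add_assoc]

theorem law_succ_apply (hreg : G.IsRegularOfDegree d) (hd : 0 < d) (x y : V) (t : ℕ) :
    law G x (t + 1) y = (∑ z ∈ G.neighborFinset y, law G x t z) * (d : ℝ≥0∞)⁻¹ := by
  classical
  rw [law, PMF.bind_apply, tsum_eq_sum (s := G.neighborFinset y), Finset.sum_mul]
  · refine Finset.sum_congr rfl fun z hz => ?_
    rw [step_apply hreg hd, if_pos ((G.mem_neighborFinset y z).mp hz).symm]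
  · intro z hz
    rw [step_apply hreg hd, if_neg, mul_zero]
    exact fun h => hz ((G.mem_neighborFinset y z).mpr h.symm)

theorem transProb_nonneg (t : ℕ) (x y : V) : 0 ≤ transProb G t x y := ENNReal.toReal_nonneg

theorem transProb_le_one (t : ℕ) (x y : V) : transProb G t x y ≤ 1 :=
  ENNReal.toReal_mono ENNReal.one_ne_top (PMF.coe_le_one _ _)

theorem hasSum_transProb (t : ℕ) (x : V) : HasSum (transProb G t x) 1 :=
  hasSum_toReal_of_tsum_eq (law G x t).tsum_coe ENNReal.one_ne_top

theorem hasSum_transProb_mul_transProb (hreg : G.IsRegularOfDegree d) (hd : 0 < d) (x y : V)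
    (m n : ℕ) :
    HasSum (fun z => transProb G m x z * transProb G n y z) (transProb G (m + n) x y) := by
  simpa only [ENNReal.toReal_mul] using!
    hasSum_toReal_of_tsum_eq (tsum_law_mul_law hreg hd x y m n) (PMF.apply_ne_top _ _)

theorem hasSum_transProb_sq (hreg : G.IsRegularOfDegree d) (hd : 0 < d) (x : V) (m : ℕ) :
    HasSum (fun z => transProb G m x z ^ 2) (transProb G (2 * m) x x) := by
  simpa only [sq, two_mul] using hasSum_transProb_mul_transProb hreg hd x x m m

theorem sum_neighborFinset_transProb (hreg : G.IsRegularOfDegree d) (hd : 0 < d) (x y : V)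
    (t : ℕ) : ∑ z ∈ G.neighborFinset y, transProb G t x z = d * transProb G (t + 1) x y := by
  have hd' : (d : ℝ) ≠ 0 := by positivity
  simp only [transProb, law_succ_apply hreg hd, ENNReal.toReal_mul, ENNReal.toReal_inv,
    ENNReal.toReal_natCast, ENNReal.toReal_sum fun z _ => PMF.apply_ne_top (law G x t) z]
  field_simp

theorem hasSum_dart_transProb_mul (hreg : G.IsRegularOfDegree d) (hd : 0 < d) (x : V) (m : ℕ) :
    HasSum (fun e : G.Dart => transProb G (m + 1) x e.fst * transProb G m x e.snd)
      (d * transProb G (2 * (m + 1)) x x) := by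
  refine hasSum_dart_of_nonneg (F := fun v w => transProb G (m + 1) x v * transProb G m x w)
    (fun _ _ => mul_nonneg (transProb_nonneg _ _ _) (transProb_nonneg _ _ _)) ?_
  simp only [← Finset.mul_sum, sum_neighborFinset_transProb hreg hd]
  refine ((hasSum_transProb_sq hreg hd x (m + 1)).mul_left (d : ℝ)).congr_fun fun v => ?_
  ring

theorem hasSum_dart_sq_sub_transProb (hreg : G.IsRegularOfDegree d) (hd : 0 < d) (x : V) (m : ℕ) :
    HasSum (fun e : G.Dart => (transProb G (m + 1) x e.fst - transProb G m x e.snd) ^ 2)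
      (d * (transProb G (2 * m) x x - transProb G (2 * (m + 1)) x x)) := by
  have hfst := hasSum_dart_fst hreg (fun _ => sq_nonneg _) (hasSum_transProb_sq hreg hd x (m + 1))
  have hsnd := hasSum_dart_snd hreg (fun _ => sq_nonneg _) (hasSum_transProb_sq hreg hd x m)
  have hcross := (hasSum_dart_transProb_mul hreg hd x m).mul_left 2
  have h := (hfst.sub hcross).add hsnd
  have hvalue : (d : ℝ) * transProb G (2 * (m + 1)) x x - 2 * (d * transProb G (2 * (m + 1)) x x) +
      d * transProb G (2 * m) x x =
        d * (transProb G (2 * m) x x - transProb G (2 * (m + 1)) x x) := by ring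
  rw [hvalue] at h
  exact h.congr_fun fun e => by ring

theorem antitone_transProb_two_mul (hreg : G.IsRegularOfDegree d) (hd : 0 < d) (x : V) :
    Antitone fun m => transProb G (2 * m) x x :=
  antitone_nat_of_succ_le fun m => by
    have h := (hasSum_dart_sq_sub_transProb hreg hd x m).nonneg fun _ => sq_nonneg _
    exact sub_nonneg.mp (nonneg_of_mul_nonneg_right h (by positivity))

end Walk

section Stationary

variable {V : Type*}

theorem hasSum_inv_card_sq [Nonempty V] :
    HasSum (fun _ : V => (Nat.card V : ℝ)⁻¹ ^ 2) (Nat.card V : ℝ)⁻¹ := by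
  rcases fintypeOrInfinite V with _ | _
  · have hcard : (Fintype.card V : ℝ) ≠ 0 := Nat.cast_ne_zero.mpr Fintype.card_ne_zero
    convert hasSum_fintype (fun _ : V => (Nat.card V : ℝ)⁻¹ ^ 2) using 1
    rw [Finset.sum_const, Finset.card_univ, nsmul_eq_mul, Nat.card_eq_fintype_card]
    field_simp
  · simp [Nat.card_eq_zero_of_infinite]

theorem exists_lt_of_hasSum_of_inv_card_lt {f : V → ℝ} {τ : ℝ} (hf : HasSum f 1)
    (hτ : (Nat.card V : ℝ)⁻¹ < τ) : ∃ v, f v < τ := by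
  cases isEmpty_or_nonempty V
  · exact absurd (hf.unique hasSum_empty) one_ne_zero
  rcases fintypeOrInfinite V with _ | _
  · have hcard : (0 : ℝ) < Fintype.card V := by exact_mod_cast Fintype.card_pos
    rw [Nat.card_eq_fintype_card, inv_lt_iff_one_lt_mul₀' hcard] at hτ
    have hsum : ∑ v, f v < ∑ _v : V, τ := by
      rwa [(hasSum_fintype f).unique hf, Finset.sum_const, Finset.card_univ, nsmul_eq_mul]
    obtain ⟨v, -, hv⟩ := Finset.exists_lt_of_sum_lt hsum
    exact ⟨v, hv⟩
  · rw [Nat.card_eq_zero_of_infinite, Nat.cast_zero, inv_zero] at hτ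
    exact (hf.summable.tendsto_cofinite_zero.eventually_lt_const hτ).exists

variable {G : SimpleGraph V} [G.LocallyFinite] {d : ℕ}

theorem statProb_eq_inv_card (hreg : G.IsRegularOfDegree d) (hd : 0 < d) (x : V) :
    statProb G x = (Nat.card V : ℝ)⁻¹ := by
  have hd' : (d : ℝ) ≠ 0 := by positivity
  have hcard : ((ENat.card V : ℝ≥0∞)).toReal = Nat.card V := by
    cases finite_or_infinite V <;> simp
  simp only [statProb, vol, hreg.degree_eq, ENNReal.tsum_const, ENNReal.toReal_div,
    ENNReal.toReal_mul, ENNReal.toReal_natCast, hcard]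
  rw [div_mul_cancel_right₀ hd']

theorem hasSum_sub_statProb_mul (hreg : G.IsRegularOfDegree d) (hd : 0 < d) (x y : V) (m n : ℕ) :
    HasSum (fun z => (transProb G m x z - statProb G x) * (transProb G n y z - statProb G y))
      (transProb G (m + n) x y - statProb G x) := by
  have : Nonempty V := ⟨x⟩
  simp only [statProb_eq_inv_card hreg hd]
  set π := (Nat.card V : ℝ)⁻¹ with hπ
  have h := (((hasSum_transProb_mul_transProb hreg hd x y m n).sub
    ((hasSum_transProb (G := G) m x).mul_left π)).sub
      ((hasSum_transProb (G := G) n y).mul_left π)).add (hasSum_inv_card_sq (V := V))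
  have hvalue : transProb G (m + n) x y - π * 1 - π * 1 + π = transProb G (m + n) x y - π := by
    ring
  rw [← hπ, hvalue] at h
  exact h.congr_fun fun z => by ring

theorem transProb_two_mul_sub_statProb_nonneg (hreg : G.IsRegularOfDegree d) (hd : 0 < d) (x : V)
    (m : ℕ) : 0 ≤ transProb G (2 * m) x x - statProb G x := by
  rw [two_mul]
  exact (hasSum_sub_statProb_mul hreg hd x x m m).nonneg fun _ => mul_self_nonneg _

theorem two_mul_abs_transProb_sub_statProb_le (hreg : G.IsRegularOfDegree d) (hd : 0 < d) (x : V)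
    (m : ℕ) : 2 * |transProb G (2 * m + 1) x x - statProb G x| ≤
      (transProb G (2 * m) x x - statProb G x) +
        (transProb G (2 * (m + 1)) x x - statProb G x) := by
  have hcross := (hasSum_sub_statProb_mul hreg hd x x m (m + 1)).mul_left 2
  have hsq := (hasSum_sub_statProb_mul hreg hd x x m m).add
    (hasSum_sub_statProb_mul hreg hd x x (m + 1) (m + 1))
  rw [← add_assoc, ← two_mul] at hcross
  rw [← two_mul, ← two_mul] at hsq
  have habs : |2 * (transProb G (2 * m + 1) x x - statProb G x)| ≤
      (transProb G (2 * m) x x - statProb G x) +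
        (transProb G (2 * (m + 1)) x x - statProb G x) := by
    refine abs_le'.mpr ⟨hasSum_le (fun z => ?_) hcross hsq, hasSum_le (fun z => ?_) hcross.neg hsq⟩
    · linear_combination two_mul_le_add_sq
        (transProb G m x z - statProb G x) (transProb G (m + 1) x z - statProb G x)
    · linear_combination two_mul_le_add_sq
        (statProb G x - transProb G m x z) (transProb G (m + 1) x z - statProb G x)
  rwa [abs_mul, abs_two] at habs

theorem abs_transProb_two_mul_add_one_sub_statProb_le (hreg : G.IsRegularOfDegree d) (hd : 0 < d)
    (x : V) (m : ℕ) :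
    |transProb G (2 * m + 1) x x - statProb G x| ≤ transProb G (2 * m) x x - statProb G x := by
  have hanti : transProb G (2 * (m + 1)) x x ≤ transProb G (2 * m) x x :=
    antitone_transProb_two_mul hreg hd x m.le_succ
  linarith [two_mul_abs_transProb_sub_statProb_le hreg hd x m]

end Stationary

section Decay

variable {V : Type*} {G : SimpleGraph V} [G.LocallyFinite] {d : ℕ}

theorem exists_transProb_two_mul_le (hreg : G.IsRegularOfDegree d) (hd : 0 < d) (x : V) (m : ℕ) :
    ∃ p : V ⊕ V, transProb G (2 * m) x x ≤
      Sum.elim (transProb G (m + 1) x) (transProb G m x) p := by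
  have hanti := antitone_transProb_two_mul hreg hd x
  rcases m.even_or_odd' with ⟨k, rfl | rfl⟩
  · exact ⟨.inr x, hanti (by omega : k ≤ 2 * k)⟩
  · exact ⟨.inl x, hanti (by omega : k + 1 ≤ 2 * k + 1)⟩

theorem sq_mul_le_transProb_sub_transProb (hreg : G.IsRegularOfDegree d) (hconn : G.Connected)
    (hbip : ¬ G.IsBipartite) (x : V) (m : ℕ) {τ δ : ℝ} (hδ : 0 ≤ δ) (hτ : statProb G x < τ)
    (hτδ : τ + δ ≤ transProb G (2 * m) x x) :
    δ ^ 2 * τ ≤ 8 * (transProb G (2 * m) x x - transProb G (2 * (m + 1)) x x) := by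
  have hd := pos_of_not_isBipartite hreg hbip
  obtain ⟨p, hp⟩ := exists_transProb_two_mul_le hreg hd x m
  obtain ⟨y, hy⟩ := exists_lt_of_hasSum_of_inv_card_lt (hasSum_transProb (G := G) m x)
    (statProb_eq_inv_card hreg hd x ▸ hτ)
  have hnonneg : ∀ q, 0 ≤ Sum.elim (transProb G (m + 1) x) (transProb G m x) q := by
    rintro (v | v) <;> exact transProb_nonneg _ _ _
  have hmass : HasSum (Sum.elim (transProb G (m + 1) x) (transProb G m x)) (1 + 1) :=
    HasSum.sum (hasSum_transProb (m + 1) x) (hasSum_transProb m x)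
  have henergy := mul_sq_mul_le_mass_mul_energy (connected_bipartiteDoubleCover hconn hbip)
    (fun q => (degree_bipartiteDoubleCover q).trans (hreg.degree_eq _) |>.ge) hnonneg hmass
    (hasSum_sqDiff_sumElim_iff.mpr (hasSum_dart_sq_sub_transProb hreg hd x m)) hδ
    (hτδ.trans hp) ⟨.inr y, hy⟩
  have hd' : (0 : ℝ) < d := by exact_mod_cast hd
  exact le_of_mul_le_mul_left (by linarith) hd'

theorem transProb_two_mul_sub_statProb_cube_le (hreg : G.IsRegularOfDegree d)
    (hconn : G.Connected) (hbip : ¬ G.IsBipartite) (x : V) (m : ℕ) :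
    (transProb G (2 * m) x x - statProb G x) ^ 3 ≤
      54 * (transProb G (2 * m) x x - transProb G (2 * (m + 1)) x x) := by
  have hd := pos_of_not_isBipartite hreg hbip
  set β := transProb G (2 * m) x x - statProb G x with hβ
  rcases (transProb_two_mul_sub_statProb_nonneg hreg hd x m).eq_or_lt' with hzero | hpos
  · have hanti : transProb G (2 * (m + 1)) x x ≤ transProb G (2 * m) x x :=
      antitone_transProb_two_mul hreg hd x m.le_succ
    rw [← hβ] at hzero
    rw [hzero]
    linarith
  · rw [← hβ] at hpos
    have hπ : 0 ≤ statProb G x := ENNReal.toReal_nonneg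
    -- `τ = π + β / 3` and `δ = 2 * β / 3` maximise the resulting lower bound `δ ^ 2 * (τ - π)`.
    have hdrop := sq_mul_le_transProb_sub_transProb hreg hconn hbip x m
      (τ := statProb G x + β / 3) (δ := 2 * β / 3) (by positivity) (by linarith) (by linarith)
    have : 0 ≤ (2 * β / 3) ^ 2 * statProb G x := by positivity
    linarith

/-- As for the differential inequality `b' ≤ -b³ / c`, each step increases `1 / b²` by at least
`2 / c`. -/
theorem two_mul_nat_mul_sq_le_of_cube_le {b : ℕ → ℝ} {c : ℝ} (hc : 0 < c) (hb : ∀ m, 0 ≤ b m)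
    (h : ∀ m, b m ^ 3 ≤ c * (b m - b (m + 1))) (m : ℕ) : 2 * m * b m ^ 2 ≤ c := by
  induction m with
  | zero => simpa using hc.le
  | succ m ih =>
    have hanti : b (m + 1) ≤ b m :=
      sub_nonneg.mp (nonneg_of_mul_nonneg_right ((pow_nonneg (hb m) 3).trans (h m)) hc)
    rcases (hb m).eq_or_lt' with hzero | hpos
    · have : b (m + 1) = 0 := (hanti.trans_eq hzero).antisymm (hb _)
      simpa [this] using hc.le
    have hnonneg := hb (m + 1)
    have hgrowth : 2 * (b m ^ 2 * b (m + 1) ^ 2) ≤ c * (b m ^ 2 - b (m + 1) ^ 2) :=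
      calc 2 * (b m ^ 2 * b (m + 1) ^ 2) = b m ^ 2 * b (m + 1) * (b (m + 1) + b (m + 1)) := by ring
        _ ≤ b m ^ 2 * b m * (b m + b (m + 1)) := by gcongr
        _ = b m ^ 3 * (b m + b (m + 1)) := by ring
        _ ≤ c * (b m - b (m + 1)) * (b m + b (m + 1)) := by
          gcongr
          exact h m
        _ = c * (b m ^ 2 - b (m + 1) ^ 2) := by ring
    refine le_of_mul_le_mul_left ?_ (pow_pos hpos 2)
    push_cast
    linear_combination hgrowth + b (m + 1) ^ 2 * ih

theorem nat_mul_sq_transProb_sub_statProb_le (hreg : G.IsRegularOfDegree d)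
    (hconn : G.Connected) (hbip : ¬ G.IsBipartite) (x : V) (t : ℕ) :
    t * (transProb G t x x - statProb G x) ^ 2 ≤ 81 := by
  have hd := pos_of_not_isBipartite hreg hbip
  have heven : ∀ m : ℕ, 2 * m * (transProb G (2 * m) x x - statProb G x) ^ 2 ≤ 54 :=
    two_mul_nat_mul_sq_le_of_cube_le (by norm_num)
      (transProb_two_mul_sub_statProb_nonneg hreg hd x) fun m => by
        simpa only [sub_sub_sub_cancel_right] using
          transProb_two_mul_sub_statProb_cube_le hreg hconn hbip x m
  rcases t.even_or_odd' with ⟨m, rfl | rfl⟩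
  · push_cast
    linarith [heven m]
  · have hodd := abs_transProb_two_mul_add_one_sub_statProb_le hreg hd x m
    rw [← sq_abs]
    rcases m.eq_zero_or_pos with rfl | hm
    · have hle : transProb G (2 * 0) x x - statProb G x ≤ 1 :=
        (sub_le_self _ ENNReal.toReal_nonneg).trans (transProb_le_one _ _ _)
      have hsq : |transProb G (2 * 0 + 1) x x - statProb G x| ^ 2 ≤ 1 :=
        pow_le_one₀ (abs_nonneg _) (hodd.trans hle)
      push_cast
      linarith
    · have hm' : (1 : ℝ) ≤ m := by exact_mod_cast hm
      calc _ ≤ (3 * m : ℝ) * (transProb G (2 * m) x x - statProb G x) ^ 2 := by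
            push_cast
            gcongr
            linarith
        _ ≤ 81 := by linarith [heven m]

theorem abs_transProb_sub_statProb_le (hreg : G.IsRegularOfDegree d) (hconn : G.Connected)
    (hbip : ¬ G.IsBipartite) (x : V) {t : ℕ} (ht : 0 < t) :
    |transProb G t x x - statProb G x| ≤ 9 / √(t : ℝ) := by
  have ht' : (0 : ℝ) < t := by exact_mod_cast ht
  have hsq : (transProb G t x x - statProb G x) ^ 2 ≤ 81 / t := by
    rw [le_div_iff₀' ht']
    exact nat_mul_sq_transProb_sub_statProb_le hreg hconn hbip x t
  calc |transProb G t x x - statProb G x| ≤ √(9 ^ 2 / t) := Real.abs_le_sqrt (by norm_num [hsq])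
    _ = 9 / √t := by rw [Real.sqrt_div' _ ht'.le, Real.sqrt_sq (by norm_num)]

end Decay

end SimpleRandomWalk

theorem mainTheorem2 {V : Type*} (G : SimpleGraph V) [G.LocallyFinite] (d : ℕ)
    (hreg : G.IsRegularOfDegree d) (hconn : G.Connected) (hbip : ¬ G.IsBipartite) (x : V) :
    (∀ t : ℕ, Even t →
      0 ≤ SimpleRandomWalk.transProb G t x x - SimpleRandomWalk.statProb G x) ∧
    (∀ t : ℕ, 0 < t → Even t →
      SimpleRandomWalk.transProb G t x x - SimpleRandomWalk.statProb G x ≤ 18 / √(t : ℝ)) ∧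
    (∀ t : ℕ, Odd t →
      |SimpleRandomWalk.transProb G t x x - SimpleRandomWalk.statProb G x| ≤ 9 / √(t : ℝ)) := by
  open SimpleRandomWalk in
  have hbound := fun t ht => abs_transProb_sub_statProb_le hreg hconn hbip x (t := t) ht
  refine ⟨fun t ht => ?_, fun t hpos _ => ?_, fun t ht => hbound t ht.pos⟩
  · obtain ⟨m, rfl⟩ := ht.exists_two_nsmul
    exact transProb_two_mul_sub_statProb_nonneg hreg (pos_of_not_isBipartite hreg hbip) x m
  · calc transProb G t x x - statProb G x ≤ 9 / √t := le_of_abs_le (hbound t hpos)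
      _ ≤ 18 / √t := by gcongr; norm_num
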